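/- **Theorem 4.1.** Let $G$ be a finite mixed graph, that is, a finite vertex set together with undirected edges and directed arcs. Suppose that $G$ is bipartite (the vertex set splits into two classes such that every edge and every arc joins vertices of different classes) and totally regular with undirected degree $r=1$ and directed degree $z=1$ (every vertex is incident to exactly one edge, is the tail of exactly one arc and is the head of exactly one arc). Let $k=\max_{u,v}\operatorname{dist}(u,v)$ be its diameter, where $\operatorname{dist}(u,v)$ is the least length of a path from $u$ to $v$ that may traverse edges in either direction and arcs in their own direction only. Put $$M_B(r,z,k)=2\left(A\,\frac{u_1^{k+1}-u_1}{u_1^2-1}+B\,\frac{u_2^{k+1}-u_2}{u_2^2-1}\right),$$ where $d=r+z$, $v=(d-1)^2+4z$ and $$u_1=\frac{d-1-\sqrt v}{2},\quad u_2=\frac{d-1+\sqrt v}{2},\quad A=\frac{\sqrt v-(d+1)}{2\sqrt v},\quad B=\frac{\sqrt v+(d+1)}{2\sqrt v}$$ (the Moore bound for bipartite mixed graphs). 1. If $k=2\kappa$ with $\kappa\ge 3$, then the order (number of vertices) of $G$ is at most $$M_B(1,1,2\kappa)-2\left\lceil\frac{\kappa}{3}\right\rceil-2\sum_{t=2}^{\kappa-1}\frac{1}{2^{2t-2}\sqrt5}\Big((1+\sqrt5)^{2t-2}-(1-\sqrt5)^{2t-2}\Big)\left\lceil\frac{\kappa-t+1}{3}\right\rceil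 .$$ 2. If $k=2\kappa$ with $\kappa=2$, then the order of $G$ is at most $M_B(1,1,2\kappa)-2\left\lceil\frac{\kappa}{3}\right\rceil$. 3. If $k=2\kappa+1$ with $\kappa\ge2$, then the order of $G$ is at most $$M_B(1,1,2\kappa+1)-2\sum_{t=1}^{\kappa-1}\frac{1}{2^{2t-1}\sqrt5}\Big((1+\sqrt5)^{2t-1}-(1-\sqrt5)^{2t-1}\Big)\left\lceil\frac{\kappa-t+1}{3}\right\rceil .$$ -/

import Mathlib

/-- A mixed graph on the vertex set `V`: undirected edges (a simple graph) together with
directed arcs (a digraph). Nothing forbids two opposite arcs, or an arc parallel to an edge;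
mixed graphs without these are a special case. -/
structure MixedGraph (V : Type*) where
  /-- the undirected edges -/
  edges : SimpleGraph V
  /-- the directed arcs -/
  arcs : Digraph V

namespace MixedGraph

variable {V : Type*}

/-- One can step from `u` to `v` along an edge (in either direction) or along an arc `u → v`;
this is adjacency in the associated digraph, where every edge is replaced by a digon. -/
def Step (G : MixedGraph V) (u v : V) : Prop :=
  G.edges.Adj u v ∨ G.arcs.Adj u v

/-- The undirected degree of `v`: the number of edges incident to `v`. -/
noncomputable def undirDegree (G : MixedGraph V) (v : V) : ℕ :=
  {u : V | G.edges.Adj v u}.ncard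

/-- The out-degree of `v`: the number of arcs emanating from `v`. -/
noncomputable def outDegree (G : MixedGraph V) (v : V) : ℕ :=
  {u : V | G.arcs.Adj v u}.ncard

/-- The in-degree of `v`: the number of arcs ending at `v`. -/
noncomputable def inDegree (G : MixedGraph V) (v : V) : ℕ :=
  {u : V | G.arcs.Adj u v}.ncard

/-- Totally regular of degree `(r, z)`: every vertex has undirected degree `r` and both
in-degree and out-degree `z`. -/
def IsTotallyRegular (G : MixedGraph V) (r z : ℕ) : Prop :=
  ∀ v : V, G.undirDegree v = r ∧ G.outDegree v = z ∧ G.inDegree v = z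

/-- Bipartite: the vertices split into two classes such that every edge and every arc joins
vertices of different classes. -/
def IsBipartite (G : MixedGraph V) : Prop :=
  ∃ side : V → Bool, ∀ u v : V, G.Step u v → side u ≠ side v

/-- `G.HasWalk n u v`: there is a (mixed) walk of length `n` from `u` to `v`. -/
inductive HasWalk (G : MixedGraph V) : ℕ → V → V → Prop
  | nil (u : V) : HasWalk G 0 u u
  | cons {n : ℕ} {u v w : V} (h : G.Step u v) (p : HasWalk G n v w) : HasWalk G (n + 1) u w

/-- The distance from `u` to `v`: the least length of a walk from `u` to `v`
(equivalently of a path, since a shortest walk is a path); it is `⊤` if there is none. -/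
noncomputable def dist (G : MixedGraph V) (u v : V) : ℕ∞ :=
  ⨅ (n : ℕ) (_ : G.HasWalk n u v), (n : ℕ∞)

/-- The diameter: the maximum of the distances over all ordered pairs of vertices. -/
noncomputable def diam (G : MixedGraph V) : ℕ∞ :=
  ⨆ (u : V) (v : V), G.dist u v

end MixedGraph

/-- The Moore bound `M_B(r, z, k)` for bipartite mixed graphs with undirected degree `r ≥ 1`,
directed degree `z ≥ 1` and diameter `k`, in closed form. -/
noncomputable def bipartiteMixedMooreBound (r z k : ℕ) : ℝ :=
  let d : ℝ := r + z
  let v : ℝ := (d - 1) ^ 2 + 4 * z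
  let u₁ : ℝ := (d - 1 - √v) / 2
  let u₂ : ℝ := (d - 1 + √v) / 2
  let A : ℝ := (√v - (d + 1)) / (2 * √v)
  let B : ℝ := (√v + (d + 1)) / (2 * √v)
  2 * (A * ((u₁ ^ (k + 1) - u₁) / (u₁ ^ 2 - 1)) + B * ((u₂ ^ (k + 1) - u₂) / (u₂ ^ 2 - 1)))

/-! The edges form an involution `e` and the arcs a permutation `a`, so walks from a root reduce to
words without `ee`, counted by Fibonacci numbers. One side of the bipartition is reached by words of
length at most `k - 1` with the parity of `k - 1`; counting them gives the Moore bound. The saving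
comes from words ending in `e`. For such a `q`, the word `q` from root `a u` and the word `q * a *
e` from root `e u` end at the same vertex `w`. A walk from `u` to the arc-predecessor of `w` has
length at most `k - 1` by parity. Its first step goes to `a u` or `e u`, so from one of these roots
`w` is also reached by a word ending in `a`, making the `e`-word redundant there
(`arcReach_or_arcReach`). Summing over all roots and over disjoint pairs `q`, `q * a * e` saves
`fibSaving` words per root on average (`card_add_fibSaving_le`). This is at least the claimed
saving, since `⌈m/3⌉ ≤ ⌊m/2⌋` for `m ≥ 2`. -/

namespace MixedGraph

/-! ### Reduced words and their Fibonacci counts. -/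

section Words

variable {V : Type*}

/-- The reduced words of length `n` in an involution `e` and a permutation `a`, as permutations;
words act from left to right. -/
def reducedWords (a e : Equiv.Perm V) : ℕ → List (Equiv.Perm V)
  | 0 => [1]
  | 1 => [a, e]
  | n + 2 => (reducedWords a e (n + 1)).map (fun q => q * a) ++
      (reducedWords a e n).map (fun q => q * a * e)

/-- The reduced words of length `n` that end in `e`. -/
def edgeWords (a e : Equiv.Perm V) : ℕ → List (Equiv.Perm V)
  | 0 => []
  | 1 => [e]
  | n + 2 => (edgeWords a e (n + 1)).map (fun q => q * a) ++
      (edgeWords a e n).map (fun q => q * a * e)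

/-- The reduced words of length `n` that do not end in `e`. -/
def arcWords (a e : Equiv.Perm V) : ℕ → List (Equiv.Perm V)
  | 0 => [1]
  | n + 1 => (reducedWords a e n).map (fun q => a * q)

theorem length_reducedWords (a e : Equiv.Perm V) (n : ℕ) :
    (reducedWords a e n).length = Nat.fib (n + 2) := by
  induction n using Nat.twoStepInduction with
  | zero => simp [reducedWords]
  | one => simp [reducedWords, Nat.fib_add_two]
  | more n h1 h2 =>
    simp only [reducedWords, List.length_append, List.length_map, h1, h2]
    rw [Nat.fib_add_two (n := n + 2)]
    exact Nat.add_comm _ _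

theorem length_edgeWords (a e : Equiv.Perm V) (n : ℕ) :
    (edgeWords a e n).length = Nat.fib n := by
  induction n using Nat.twoStepInduction with
  | zero => simp [edgeWords]
  | one => simp [edgeWords]
  | more n h1 h2 =>
    simp only [edgeWords, List.length_append, List.length_map, h1, h2]
    rw [Nat.fib_add_two (n := n)]
    omega

theorem length_arcWords (a e : Equiv.Perm V) (n : ℕ) :
    (arcWords a e n).length = Nat.fib (n + 1) := by
  cases n with
  | zero => simp [arcWords]
  | succ n => simp [arcWords, length_reducedWords]

theorem mul_arc_mem_reducedWords {a e q : Equiv.Perm V} {n : ℕ} (h : q ∈ reducedWords a e n) :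
    q * a ∈ reducedWords a e (n + 1) := by
  cases n with
  | zero => simp_all [reducedWords]
  | succ n => simpa [reducedWords] using Or.inl h

theorem mul_arc_mul_edge_mem_reducedWords {a e q : Equiv.Perm V} {n : ℕ}
    (h : q ∈ reducedWords a e n) : q * a * e ∈ reducedWords a e (n + 2) := by
  simpa [reducedWords] using Or.inr h

/-- An `e` placed before a word starting with `e` cancels, which shortens the word by one instead of
lengthening it; the parity is the same either way. -/
theorem mul_edge_mem_reducedWords {a e q : Equiv.Perm V} (he : e * e = 1) {n : ℕ}
    (h : q ∈ reducedWords a e n) :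
    ∃ m ≤ n + 1, m % 2 = (n + 1) % 2 ∧ q * e ∈ reducedWords a e m := by
  match n, h with
  | 0, h => exact ⟨1, le_rfl, rfl, by simp_all [reducedWords]⟩
  | 1, h =>
    rcases (by simpa [reducedWords] using h : q = a ∨ q = e) with rfl | rfl
    · exact ⟨2, le_rfl, rfl, by simp [reducedWords]⟩
    · exact ⟨0, by omega, rfl, by simp [reducedWords, he]⟩
  | n + 2, h =>
    simp only [reducedWords, List.mem_append, List.mem_map] at h
    rcases h with ⟨q, hq, rfl⟩ | ⟨q, hq, rfl⟩
    · exact ⟨n + 3, by omega, rfl, mul_arc_mul_edge_mem_reducedWords hq⟩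
    · refine ⟨n + 1, by omega, by omega, ?_⟩
      rw [mul_assoc _ e e, he, mul_one]
      exact mul_arc_mem_reducedWords hq

theorem reducedWords_subset {a e q : Equiv.Perm V} {n : ℕ} (h : q ∈ reducedWords a e n) :
    q ∈ edgeWords a e n ∨ q ∈ arcWords a e n := by
  induction n using Nat.twoStepInduction generalizing q with
  | zero => simp_all [reducedWords, arcWords]
  | one => simp_all [reducedWords, arcWords, edgeWords, or_comm]
  | more n h1 h2 =>
    simp only [reducedWords, List.mem_append, List.mem_map] at h
    rcases h with ⟨q, hq, rfl⟩ | ⟨q, hq, rfl⟩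
    · rcases h2 hq with h | h
      · exact Or.inl (by simpa [edgeWords] using Or.inl h)
      · simp only [arcWords, List.mem_map] at h ⊢
        obtain ⟨r, hr, rfl⟩ := h
        exact Or.inr ⟨r * a, mul_arc_mem_reducedWords hr, (mul_assoc _ _ _).symm⟩
    · rcases h1 hq with h | h
      · exact Or.inl (by simpa [edgeWords] using Or.inr h)
      · right
        cases n with
        | zero =>
          obtain rfl : q = 1 := by simpa [arcWords] using h
          simp [arcWords, reducedWords]
        | succ n =>
          simp only [arcWords, List.mem_map] at h ⊢
          obtain ⟨r, hr, rfl⟩ := h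
          exact ⟨r * a * e, mul_arc_mul_edge_mem_reducedWords hr, by simp only [mul_assoc]⟩

theorem exists_reducedWords_of_hasWalk {G : MixedGraph V} {a e : Equiv.Perm V} (he : e * e = 1)
    (hstep : ∀ u v, G.Step u v → v = a u ∨ v = e u) {n : ℕ} {u w : V} (h : G.HasWalk n u w) :
    ∃ m ≤ n, m % 2 = n % 2 ∧ ∃ q ∈ reducedWords a e m, q u = w := by
  induction h with
  | nil u => exact ⟨0, le_rfl, rfl, 1, by simp [reducedWords], rfl⟩
  | @cons n u v w hs _ ih =>
    obtain ⟨m, hm, hpar, q, hq, rfl⟩ := ih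
    rcases hstep _ _ hs with rfl | rfl
    · exact ⟨m + 1, by omega, by omega, q * a, mul_arc_mem_reducedWords hq, rfl⟩
    · obtain ⟨l, hl, hpar', hmem⟩ := mul_edge_mem_reducedWords he hq
      exact ⟨l, by omega, by omega, q * e, hmem, rfl⟩

end Words

/-! ### Permutations from regularity; walks, parity and sides. -/

section Structure

variable {V : Type*}

theorem exists_perms_of_isTotallyRegular [Finite V] {G : MixedGraph V}
    (hreg : G.IsTotallyRegular 1 1) :
    ∃ a e : Equiv.Perm V, e * e = 1 ∧ ∀ u v, G.Step u v ↔ v = a u ∨ v = e u := by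
  have hedge : ∀ v, ∃ w, ∀ u, G.edges.Adj v u ↔ u = w := fun v => by
    obtain ⟨w, hw⟩ := Set.ncard_eq_one.mp (hreg v).1
    exact ⟨w, fun u => by simpa using Set.ext_iff.mp hw u⟩
  have hout : ∀ v, ∃ w, ∀ u, G.arcs.Adj v u ↔ u = w := fun v => by
    obtain ⟨w, hw⟩ := Set.ncard_eq_one.mp (hreg v).2.1
    exact ⟨w, fun u => by simpa using Set.ext_iff.mp hw u⟩
  have hin : ∀ v, ∃ w, ∀ u, G.arcs.Adj u v ↔ u = w := fun v => by
    obtain ⟨w, hw⟩ := Set.ncard_eq_one.mp (hreg v).2.2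
    exact ⟨w, fun u => by simpa using Set.ext_iff.mp hw u⟩
  choose e he using hedge
  choose a ha using hout
  choose b hb using hin
  have hee : ∀ v, e (e v) = v := fun v => ((he _ _).mp ((he v _).mpr rfl).symm).symm
  refine ⟨⟨a, b, fun v => ((hb _ _).mp ((ha v _).mpr rfl)).symm,
    fun v => ((ha _ _).mp ((hb v _).mpr rfl)).symm⟩, ⟨e, e, hee, hee⟩, ?_, ?_⟩
  · ext v
    exact hee v
  · intro u v
    simp only [Step, he, ha, Equiv.coe_fn_mk]
    exact or_comm

theorem exists_hasWalk_of_diam_le {G : MixedGraph V} {k : ℕ} (h : G.diam ≤ k) (u v : V) :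
    ∃ n ≤ k, G.HasWalk n u v := by
  have h1 : G.dist u v ≤ k := le_trans (le_iSup₂ (f := fun u v => G.dist u v) u v) h
  by_contra! hcon
  have h2 : ((k + 1 : ℕ) : ℕ∞) ≤ G.dist u v := by
    refine le_iInf₂ fun n hn => ?_
    have : k < n := by
      by_contra! hle
      exact hcon n hle hn
    exact_mod_cast this
  have h3 : ((k + 1 : ℕ) : ℕ∞) ≤ k := h2.trans h1
  have h4 : k + 1 ≤ k := by exact_mod_cast h3
  omega

/-- `side` is switched `n` times: the side of a vertex reached from `u` by a walk of length `n`. -/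
theorem side_of_hasWalk {G : MixedGraph V} {side : V → Bool}
    (hside : ∀ u v, G.Step u v → side u ≠ side v) {n : ℕ} {u v : V} (h : G.HasWalk n u v) :
    side v = (side u ^^ decide (n % 2 = 1)) := by
  induction h with
  | nil u => simp
  | @cons n u v w hs _ ih =>
    rw [ih]
    have := hside _ _ hs
    rcases Nat.mod_two_eq_zero_or_one n with h | h <;>
      have h' : (n + 1) % 2 = 1 - n % 2 := by omega
    all_goals
      simp only [h', h]
      cases hu : side u <;> cases hv : side v <;> simp_all

theorem side_of_mem_edgeWords {a e : Equiv.Perm V} {side : V → Bool}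
    (ha : ∀ u, side (a u) = !side u) (he : ∀ u, side (e u) = !side u) {n : ℕ}
    {q : Equiv.Perm V} (hq : q ∈ edgeWords a e n) (u : V) :
    side (q u) = (side u ^^ decide (n % 2 = 1)) := by
  induction n using Nat.twoStepInduction generalizing q u with
  | zero => simp [edgeWords] at hq
  | one =>
    obtain rfl : q = e := by simpa [edgeWords] using hq
    simp [he]
  | more n h1 h2 =>
    simp only [edgeWords, List.mem_append, List.mem_map] at hq
    rcases hq with ⟨q, hq, rfl⟩ | ⟨q, hq, rfl⟩
    · rw [Equiv.Perm.mul_apply, h2 hq, ha]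
      rcases Nat.mod_two_eq_zero_or_one n with h | h <;>
        have h' : (n + 1) % 2 = 1 - n % 2 := by omega
      all_goals simp [h', h]
    · rw [Equiv.Perm.mul_apply, Equiv.Perm.mul_apply, h1 hq, ha, he]
      simp

end Structure
end MixedGraph
namespace MixedGraph

/-! ### Redundant words and averaging over roots. -/

section Counting

variable {V : Type*}

/-- `w` is reached from `u` by a word in `arcWords` whose length is one of
`b, b + 2, …, b + 2 (c - 1)`. -/
def ArcReach (a e : Equiv.Perm V) (b c : ℕ) (u w : V) : Prop :=
  ∃ i < c, ∃ p ∈ arcWords a e (2 * i + b), p u = w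

theorem arcReach_of_hasWalk {G : MixedGraph V} {a e : Equiv.Perm V} (he : e * e = 1)
    (hstep : ∀ u v, G.Step u v ↔ v = a u ∨ v = e u) {b c n : ℕ} {u y : V} (hb : b < 2)
    (hn : n + 1 < 2 * c + b) (hpar : (n + 1) % 2 = b) (h : G.HasWalk n u y) :
    ArcReach a e b c u (a y) := by
  obtain ⟨m, hm, hmpar, q, hq, rfl⟩ :=
    exists_reducedWords_of_hasWalk he (fun u v => (hstep u v).mp) h
  refine ⟨(m + 1 - b) / 2, by omega, a * q, ?_, rfl⟩
  rw [show 2 * ((m + 1 - b) / 2) + b = m + 1 by omega]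
  exact List.mem_map_of_mem hq

theorem arcReach_or_arcReach {G : MixedGraph V} {a e : Equiv.Perm V} (he : e * e = 1)
    (hstep : ∀ u v, G.Step u v ↔ v = a u ∨ v = e u) {side : V → Bool}
    (hside : ∀ u v, G.Step u v → side u ≠ side v) {b c k : ℕ} (hb : b < 2) (hc : 2 ≤ c)
    (hk : k + 1 = 2 * c + b) (hdiam : G.diam ≤ k) {i : ℕ} {q : Equiv.Perm V}
    (hq : q ∈ edgeWords a e (2 * i + b)) (u : V) :
    ArcReach a e b c (a u) (q (a u)) ∨ ArcReach a e b c (e u) ((q * a * e) (e u)) := by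
  have hee : ∀ v, e (e v) = v := fun v => by rw [← Equiv.Perm.mul_apply, he]; rfl
  have ha : ∀ u, side (a u) = !side u := fun u =>
    Bool.eq_not.mpr (hside u (a u) ((hstep _ _).mpr (Or.inl rfl))).symm
  have hes : ∀ u, side (e u) = !side u := fun u =>
    Bool.eq_not.mpr (hside u (e u) ((hstep _ _).mpr (Or.inr rfl))).symm
  -- `y` is the arc-predecessor of the common endpoint, so any walk to `y` extends by a final arc.
  obtain ⟨y, hy⟩ := a.surjective (q (a u))
  have hsy : side y = (side u ^^ decide (b = 1)) := by
    have h1 := side_of_mem_edgeWords ha hes hq (a u)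
    rw [← hy, ha, ha] at h1
    rw [show (2 * i + b) % 2 = b by omega] at h1
    revert h1
    generalize decide (b = 1) = d
    cases side y <;> cases side u <;> cases d <;> decide
  obtain ⟨m, hm, hw⟩ := exists_hasWalk_of_diam_le hdiam u y
  have hpar : m % 2 = b := by
    have h1 := side_of_hasWalk hside hw
    rw [hsy] at h1
    have h2 : decide (b = 1) = decide (m % 2 = 1) := Bool.xor_right_inj.mp h1
    rw [decide_eq_decide] at h2
    omega
  rw [Equiv.Perm.mul_apply, Equiv.Perm.mul_apply, hee, ← hy]
  cases hw with
  | nil =>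
    -- If `y = u`, the walk `e u → u → a u` serves; its length 2 is allowed because `2 ≤ c`.
    exact Or.inr (arcReach_of_hasWalk he hstep hb (n := 1) (by omega) (by omega)
      (.cons ((hstep _ _).mpr (Or.inr (hee u).symm)) (.nil u)))
  | @cons n _ v _ hs p =>
    rcases (hstep _ _).mp hs with rfl | rfl
    · exact Or.inl (arcReach_of_hasWalk he hstep hb (by omega) hpar p)
    · exact Or.inr (arcReach_of_hasWalk he hstep hb (by omega) hpar p)

open Classical in
/-- The number of roots from which the endpoint of the word `q` is reached by no word in
`arcWords`. -/
noncomputable def essentialRoots [Fintype V] (a e : Equiv.Perm V) (b c : ℕ)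
    (q : Equiv.Perm V) : ℕ :=
  (Finset.univ.filter fun u => ¬ ArcReach a e b c u (q u)).card

theorem essentialRoots_le [Fintype V] (a e : Equiv.Perm V) (b c : ℕ) (q : Equiv.Perm V) :
    essentialRoots a e b c q ≤ Fintype.card V :=
  Finset.card_le_univ _

theorem essentialRoots_add_le [Fintype V] {G : MixedGraph V} {a e : Equiv.Perm V}
    (he : e * e = 1) (hstep : ∀ u v, G.Step u v ↔ v = a u ∨ v = e u) {side : V → Bool}
    (hside : ∀ u v, G.Step u v → side u ≠ side v) {b c k : ℕ} (hb : b < 2) (hc : 2 ≤ c)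
    (hk : k + 1 = 2 * c + b) (hdiam : G.diam ≤ k) {i : ℕ} {q : Equiv.Perm V}
    (hq : q ∈ edgeWords a e (2 * i + b)) :
    essentialRoots a e b c q + essentialRoots a e b c (q * a * e) ≤ Fintype.card V := by
  classical
  -- Reindexing the roots by a permutation `f` lets both counts run over the same `u`.
  have htrans : ∀ (f r : Equiv.Perm V), essentialRoots a e b c r =
      (Finset.univ.filter fun u => ¬ ArcReach a e b c (f u) (r (f u))).card := fun f r => by
    unfold essentialRoots
    refine (Finset.card_equiv f fun u => ?_).symm
    simp
  rw [htrans a q, htrans e (q * a * e), ← Finset.card_union_of_disjoint]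
  · exact Finset.card_le_univ _
  · rw [Finset.disjoint_filter]
    intro u _ h1 h2
    exact (arcReach_or_arcReach he hstep hside hb hc hk hdiam hq u).elim h1 h2

/-- The guaranteed number of redundant words: `fib (2 (c - 2) + b) + fib (2 (c - 4) + b) + …`. -/
def fibSaving (b : ℕ) : ℕ → ℕ
  | 0 => 0
  | 1 => 0
  | c + 2 => fibSaving b c + Nat.fib (2 * c + b)

theorem sum_map_le_length_mul {α : Type*} (l : List α) (g : α → ℕ) (N : ℕ)
    (h : ∀ x ∈ l, g x ≤ N) : (l.map g).sum ≤ l.length * N := by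
  simpa using List.sum_le_card_nsmul (l.map g) N (by simpa using h)

theorem sum_map_flatMap_range {α : Type*} (f : ℕ → List α) (g : α → ℕ) (c : ℕ) :
    (((List.range c).flatMap f).map g).sum = ∑ i ∈ Finset.range c, ((f i).map g).sum := by
  induction c with
  | zero => simp
  | succ c ih =>
    rw [List.range_succ, List.flatMap_append, List.map_append, List.sum_append, ih,
      Finset.sum_range_succ]
    simp

theorem length_flatMap_range {α : Type*} (f : ℕ → List α) (c : ℕ) :
    ((List.range c).flatMap f).length = ∑ i ∈ Finset.range c, (f i).length := by
  simpa using sum_map_flatMap_range f (fun _ => 1) c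

theorem length_filter_eq_sum {α : Type*} (l : List α) (p : α → Prop) [DecidablePred p] :
    (l.filter fun x => p x).length = (l.map fun x => if p x then 1 else 0).sum := by
  induction l with
  | nil => rfl
  | cons x l ih =>
    by_cases hx : p x
    · simp [hx, ih, add_comm]
    · simp [hx, ih]

theorem sum_sum_map_comm {α β : Type*} (s : Finset β) (l : List α) (f : β → α → ℕ) :
    ∑ u ∈ s, (l.map (f u)).sum = (l.map fun q => ∑ u ∈ s, f u q).sum := by
  induction l with
  | nil => simp
  | cons x l ih => simp [Finset.sum_add_distrib, ih]

/-- Two consecutive lengths of the same parity are treated at once: each shorter word `q` is paired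
with `q * a * e`, and the longer words starting with `a` get the trivial bound `N`. The two-step
induction keeps the pairs disjoint. -/
theorem sum_edgeWords_add_fibSaving_le (a e : Equiv.Perm V) (b : ℕ) (g : Equiv.Perm V → ℕ)
    (N : ℕ) (hg : ∀ q, g q ≤ N)
    (hpair : ∀ i, ∀ q ∈ edgeWords a e (2 * i + b), g q + g (q * a * e) ≤ N) (c : ℕ) :
    ∑ i ∈ Finset.range c, ((edgeWords a e (2 * i + b)).map g).sum + N * fibSaving b c ≤
      N * ∑ i ∈ Finset.range c, Nat.fib (2 * i + b) := by
  induction c using Nat.twoStepInduction with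
  | zero => simp [fibSaving]
  | one =>
    have := sum_map_le_length_mul (edgeWords a e (2 * 0 + b)) g N fun q _ => hg q
    rw [length_edgeWords] at this
    simpa [fibSaving, mul_comm] using this
  | more c ih _ =>
    rw [Finset.sum_range_succ, Finset.sum_range_succ, Finset.sum_range_succ,
      Finset.sum_range_succ, fibSaving]
    have h1 : ((edgeWords a e (2 * (c + 1) + b)).map g).sum +
        ((edgeWords a e (2 * c + b)).map g).sum ≤ N * Nat.fib (2 * (c + 1) + b) := by
      rw [show 2 * (c + 1) + b = 2 * c + b + 2 by ring, edgeWords, Nat.fib_add_two,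
        List.map_append, List.sum_append, List.map_map, List.map_map]
      have h2 := sum_map_le_length_mul (edgeWords a e (2 * c + b + 1))
        (g ∘ fun q => q * a) N fun q _ => hg _
      have h3 := sum_map_le_length_mul (edgeWords a e (2 * c + b))
        (fun q => g q + g (q * a * e)) N fun q hq => hpair c q hq
      rw [List.sum_map_add] at h3
      rw [length_edgeWords] at h2 h3
      have h4 : (List.map (g ∘ fun q => q * a * e) (edgeWords a e (2 * c + b))).sum =
        (List.map (fun q => g (q * a * e)) (edgeWords a e (2 * c + b))).sum := rfl
      rw [h4]
      linarith
    linarith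

theorem sum_fib_add_fib (b c : ℕ) :
    ∑ i ∈ Finset.range c, Nat.fib (2 * i + b + 2) + Nat.fib (b + 1) = Nat.fib (2 * c + b + 1) := by
  induction c with
  | zero => simp
  | succ c ih =>
    rw [Finset.sum_range_succ, show 2 * (c + 1) + b + 1 = (2 * c + b + 1) + 2 by ring,
      Nat.fib_add_two (n := 2 * c + b + 1), ← ih]
    ring

theorem card_filter_side [Fintype V] {side : V → Bool} (e : Equiv.Perm V)
    (he : ∀ u, side (e u) = !side u) (s : Bool) :
    Fintype.card V = 2 * (Finset.univ.filter fun w => side w = s).card := by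
  have h1 : (Finset.univ.filter fun w => side w = s).card =
      (Finset.univ.filter fun w => ¬ side w = s).card := by
    refine Finset.card_equiv e fun u => ?_
    simp [he]
  have h2 := Finset.card_filter_add_card_filter_not (s := (Finset.univ : Finset V))
    (fun w => side w = s)
  rw [Finset.card_univ] at h2
  omega

theorem card_add_fibSaving_le [Fintype V] {G : MixedGraph V} (hbip : G.IsBipartite)
    (hreg : G.IsTotallyRegular 1 1) {b c k : ℕ} (hb : b < 2) (hc : 2 ≤ c)
    (hk : k + 1 = 2 * c + b) (hdiam : G.diam = k) :
    Fintype.card V + 2 * fibSaving b c + 2 ≤ 2 * Nat.fib (k + 2) := by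
  classical
  obtain ⟨a, e, he, hstep⟩ := exists_perms_of_isTotallyRegular hreg
  obtain ⟨side, hside⟩ := hbip
  have hes : ∀ u, side (e u) = !side u := fun u =>
    Bool.eq_not.mpr (hside u (e u) ((hstep _ _).mpr (Or.inr rfl))).symm
  set N := Fintype.card V with hN
  have hNpos : 0 < N := by
    rw [hN, Fintype.card_pos_iff]
    by_contra hV
    rw [not_nonempty_iff] at hV
    have h0 : G.diam = 0 := by simp [diam]
    rw [hdiam] at h0
    have : k = 0 := by exact_mod_cast h0
    omega
  let arcList := (List.range c).flatMap fun i => arcWords a e (2 * i + b)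
  let edgeList := (List.range c).flatMap fun i => edgeWords a e (2 * i + b)
  -- The side at parity `b` from `u` is half of `V`; it is covered by the words not ending in `e`
  -- and the irredundant ones ending in `e`.
  have hroot : ∀ u, N ≤ 2 * (∑ i ∈ Finset.range c, Nat.fib (2 * i + b + 1) +
      (edgeList.map fun q => if ¬ ArcReach a e b c u (q u) then 1 else 0).sum) := fun u => by
    rw [hN, card_filter_side e hes (side u ^^ decide (b = 1))]
    have hsub : (Finset.univ.filter fun w => side w = (side u ^^ decide (b = 1))) ⊆
        (arcList.map fun p => p u).toFinset ∪
          ((edgeList.filter fun q => ¬ ArcReach a e b c u (q u)).map fun q => q u).toFinset := by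
      intro w hw
      simp only [Finset.mem_filter, Finset.mem_univ, true_and] at hw
      obtain ⟨m, hm, hwalk⟩ := exists_hasWalk_of_diam_le hdiam.le u w
      have hpar : m % 2 = b := by
        have h1 := side_of_hasWalk hside hwalk
        rw [hw] at h1
        have h2 : decide (b = 1) = decide (m % 2 = 1) := Bool.xor_right_inj.mp h1
        rw [decide_eq_decide] at h2
        omega
      obtain ⟨l, hl, hlpar, q, hq, rfl⟩ :=
        exists_reducedWords_of_hasWalk he (fun u v => (hstep u v).mp) hwalk
      obtain ⟨i, rfl⟩ : ∃ i, l = 2 * i + b := ⟨(l - b) / 2, by omega⟩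
      have hi : i < c := by omega
      by_cases hA : ArcReach a e b c u (q u)
      · obtain ⟨j, hj, p, hp, hpq⟩ := hA
        refine Finset.mem_union_left _ (List.mem_toFinset.mpr (List.mem_map.mpr ⟨p, ?_, hpq⟩))
        exact List.mem_flatMap.mpr ⟨j, List.mem_range.mpr hj, hp⟩
      · refine Finset.mem_union_right _ (List.mem_toFinset.mpr (List.mem_map.mpr ⟨q, ?_, rfl⟩))
        refine List.mem_filter.mpr ⟨List.mem_flatMap.mpr ⟨i, List.mem_range.mpr hi, ?_⟩,
          by simpa using hA⟩
        exact (reducedWords_subset hq).resolve_right fun h => hA ⟨i, hi, q, h, rfl⟩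
    refine Nat.mul_le_mul_left 2 ((Finset.card_le_card hsub).trans
      ((Finset.card_union_le _ _).trans (Nat.add_le_add
        ((List.toFinset_card_le _).trans ?_) ((List.toFinset_card_le _).trans ?_))))
    · simp only [arcList, List.length_map, length_flatMap_range, length_arcWords]
      exact le_rfl
    · rw [List.length_map, length_filter_eq_sum]
  have hsum : ∑ u : V, (edgeList.map fun q => if ¬ ArcReach a e b c u (q u) then 1 else 0).sum =
      ∑ i ∈ Finset.range c, ((edgeWords a e (2 * i + b)).map (essentialRoots a e b c)).sum := by
    rw [sum_sum_map_comm, ← sum_map_flatMap_range]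
    refine congrArg List.sum (List.map_congr_left fun q _ => ?_)
    rw [essentialRoots, Finset.card_filter]
  have hmain := sum_edgeWords_add_fibSaving_le a e b (essentialRoots a e b c) N
    (essentialRoots_le a e b c)
    (fun i q hq => essentialRoots_add_le he hstep hside hb hc hk hdiam.le hq) c
  have htot := Finset.sum_le_sum fun u (_ : u ∈ (Finset.univ : Finset V)) => hroot u
  rw [← Finset.mul_sum, Finset.sum_add_distrib, hsum] at htot
  simp only [Finset.sum_const, Finset.card_univ, smul_eq_mul, ← hN] at htot
  have hfib := sum_fib_add_fib b c
  have hsplit : ∑ i ∈ Finset.range c, Nat.fib (2 * i + b + 2) =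
      ∑ i ∈ Finset.range c, Nat.fib (2 * i + b) +
        ∑ i ∈ Finset.range c, Nat.fib (2 * i + b + 1) := by
    rw [← Finset.sum_add_distrib]
    exact Finset.sum_congr rfl fun i _ => Nat.fib_add_two
  have hb1 : Nat.fib (b + 1) = 1 := by interval_cases b <;> rfl
  rw [show 2 * c + b + 1 = k + 2 by omega, hb1, hsplit] at hfib
  rw [← hfib]
  -- The bound was summed over all `N` roots; the factor `N` is now cancelled.
  refine Nat.le_of_mul_le_mul_left ?_ hNpos
  nlinarith

end Counting
end MixedGraph
namespace MixedGraph

/-! ### Binet formulas and comparison with the stated sums. -/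

section ClosedForms

theorem binet_eq_fib (n : ℕ) :
    1 / (2 ^ n * √5) * ((1 + √5) ^ n - (1 - √5) ^ n) = (Nat.fib n : ℝ) := by
  rw [Real.coe_fib_eq, Real.goldenRatio, Real.goldenConj, div_pow, div_pow]
  field_simp

theorem bipartiteMixedMooreBound_one_one (k : ℕ) :
    bipartiteMixedMooreBound 1 1 k = 2 * ((Nat.fib (k + 2) : ℝ) - 1) := by
  have h5 : √(5 : ℝ) ^ 2 = 5 := Real.sq_sqrt (by norm_num)
  have hs : √(5 : ℝ) ≠ 0 := by positivity
  have hv : (((1 : ℕ) : ℝ) + ((1 : ℕ) : ℝ) - 1) ^ 2 + 4 * ((1 : ℕ) : ℝ) = 5 := by norm_num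
  have hu₁ : (((1 : ℕ) : ℝ) + ((1 : ℕ) : ℝ) - 1 - √5) / 2 = Real.goldenConj := by
    rw [Real.goldenConj]; norm_num
  have hu₂ : (((1 : ℕ) : ℝ) + ((1 : ℕ) : ℝ) - 1 + √5) / 2 = Real.goldenRatio := by
    rw [Real.goldenRatio]; norm_num
  have hA : (√5 - (((1 : ℕ) : ℝ) + ((1 : ℕ) : ℝ) + 1)) / (2 * √5) =
      -(Real.goldenConj ^ 2) / √5 := by
    rw [Real.goldenConj]; field_simp; push_cast; nlinarith
  have hB : (√5 + (((1 : ℕ) : ℝ) + ((1 : ℕ) : ℝ) + 1)) / (2 * √5) =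
      Real.goldenRatio ^ 2 / √5 := by
    rw [Real.goldenRatio]; field_simp; push_cast; nlinarith
  -- Both bases satisfy `x ^ 2 - 1 = x`, so the geometric quotients collapse and Binet's formula
  -- remains.
  have hquot : ∀ x : ℝ, x ≠ 0 → x ^ 2 = x + 1 → (x ^ (k + 1) - x) / (x ^ 2 - 1) = x ^ k - 1 := by
    intro x hx hx2
    rw [hx2, add_sub_cancel_right, pow_succ]
    field_simp
  have hdiff : Real.goldenRatio ^ 2 - Real.goldenConj ^ 2 = √5 := by
    rw [Real.goldenRatio, Real.goldenConj]; ring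
  unfold bipartiteMixedMooreBound
  simp only [hv, hu₁, hu₂, hA, hB]
  rw [hquot _ Real.goldenRatio_ne_zero Real.goldenRatio_sq,
    hquot _ Real.goldenConj_ne_zero Real.goldenConj_sq, Real.coe_fib_eq, pow_add, pow_add]
  field_simp
  linear_combination -hdiff

theorem ceil_div_three_le_half {m : ℕ} (hm : 2 ≤ m) : (⌈(m : ℝ) / 3⌉ : ℝ) ≤ ((m / 2 : ℕ) : ℝ) := by
  have h : ⌈(m : ℝ) / 3⌉ ≤ ((m / 2 : ℕ) : ℤ) := by
    rw [Int.ceil_le, div_le_iff₀ (by norm_num)]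
    exact_mod_cast (by omega : m ≤ m / 2 * 3)
  simpa only [Int.cast_natCast] using (Int.cast_le (R := ℝ)).mpr h

theorem ceil_sub_add_one_div_three_le {κ t : ℕ} (ht : 1 ≤ t) (hκ : t ≤ κ - 1) :
    (⌈((κ : ℝ) - (t : ℝ) + 1) / 3⌉ : ℝ) ≤ (((κ - (t - 1)) / 2 : ℕ) : ℝ) := by
  have h := ceil_div_three_le_half (m := κ - (t - 1)) (by omega)
  have hcast : ((κ - (t - 1) : ℕ) : ℝ) = (κ : ℝ) - t + 1 := by
    rw [Nat.cast_sub (by omega), Nat.cast_sub ht]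
    push_cast
    ring
  rwa [hcast] at h

theorem sum_fib_even_add_one (c : ℕ) :
    ∑ j ∈ Finset.range (c + 1), Nat.fib (2 * j) + 1 = Nat.fib (2 * c + 1) := by
  induction c with
  | zero => simp
  | succ c ih =>
    rw [Finset.sum_range_succ, show 2 * (c + 1) + 1 = 2 * c + 1 + 2 by ring,
      Nat.fib_add_two (n := 2 * c + 1), ← ih, show 2 * c + 1 + 1 = 2 * (c + 1) by ring]
    ring

theorem sum_fib_odd (c : ℕ) :
    ∑ j ∈ Finset.range (c + 1), Nat.fib (2 * j + 1) = Nat.fib (2 * c + 2) := by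
  induction c with
  | zero => simp
  | succ c ih =>
    rw [Finset.sum_range_succ, ih, show 2 * (c + 1) + 2 = 2 * c + 2 + 2 by ring,
      Nat.fib_add_two (n := 2 * c + 2), show 2 * c + 2 + 1 = 2 * (c + 1) + 1 by ring]

theorem sum_mul_half_add_two (f : ℕ → ℕ) (c : ℕ) :
    ∑ j ∈ Finset.range (c + 2), f j * ((c + 2 - j) / 2) =
      ∑ j ∈ Finset.range c, f j * ((c - j) / 2) + ∑ j ∈ Finset.range (c + 1), f j := by
  rw [Finset.sum_range_succ, Finset.sum_range_succ, Finset.sum_range_succ f, ← add_assoc,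
    ← Finset.sum_add_distrib, show (c + 2 - (c + 1)) / 2 = 0 by omega,
    show (c + 2 - c) / 2 = 1 by omega, mul_zero, mul_one, add_zero]
  congr 1
  refine Finset.sum_congr rfl fun j hj => ?_
  rw [Finset.mem_range] at hj
  rw [show (c + 2 - j) / 2 = (c - j) / 2 + 1 by omega, mul_add, mul_one]

/-- Each odd-indexed Fibonacci number is 1 plus the preceding even-indexed ones; the ones add up to
`c / 2`. -/
theorem fibSaving_one (c : ℕ) :
    fibSaving 1 c = c / 2 + ∑ j ∈ Finset.range c, Nat.fib (2 * j) * ((c - j) / 2) := by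
  induction c using Nat.twoStepInduction with
  | zero => simp [fibSaving]
  | one => simp [fibSaving]
  | more c ih _ =>
    rw [fibSaving, ih, sum_mul_half_add_two, ← sum_fib_even_add_one]
    omega

theorem fibSaving_zero (c : ℕ) :
    fibSaving 0 (c + 1) = ∑ j ∈ Finset.range c, Nat.fib (2 * j + 1) * ((c - j) / 2) := by
  induction c using Nat.twoStepInduction with
  | zero => simp [fibSaving]
  | one => simp [fibSaving]
  | more c ih _ =>
    rw [fibSaving, ih, sum_mul_half_add_two, sum_fib_odd]
    rfl

/-- The shift `t = j + 1` matches the stated sums with those for `fibSaving`. -/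
theorem sum_Icc_pred_le (f : ℕ → ℕ) {l : ℕ} (hl : 1 ≤ l) (κ : ℕ) :
    ∑ t ∈ Finset.Icc l (κ - 1), (f (t - 1) : ℝ) ≤ ((∑ j ∈ Finset.range κ, f j : ℕ) : ℝ) := by
  have hsub : Finset.Icc l (κ - 1) ⊆ Finset.Ico 1 (κ + 1) := fun t ht => by
    simp only [Finset.mem_Icc, Finset.mem_Ico] at ht ⊢
    omega
  rw [← Nat.cast_sum, Nat.cast_le]
  refine (Finset.sum_le_sum_of_subset hsub).trans ?_
  rw [Finset.sum_Ico_eq_sum_range]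
  simp

theorem sum_even_le_fibSaving {κ : ℕ} (hκ : 2 ≤ κ) :
    (⌈(κ : ℝ) / 3⌉ : ℝ) + ∑ t ∈ Finset.Icc 2 (κ - 1),
      1 / (2 ^ (2 * t - 2) * √5) * ((1 + √5) ^ (2 * t - 2) - (1 - √5) ^ (2 * t - 2))
        * (⌈((κ : ℝ) - (t : ℝ) + 1) / 3⌉ : ℝ) ≤ (fibSaving 1 κ : ℝ) := by
  rw [fibSaving_one]
  rw [Nat.cast_add]
  refine add_le_add (ceil_div_three_le_half hκ) ?_
  have h := sum_Icc_pred_le (fun j => Nat.fib (2 * j) * ((κ - j) / 2)) one_le_two κ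
  refine le_trans (Finset.sum_le_sum fun t ht => ?_) h
  rw [Finset.mem_Icc] at ht
  rw [binet_eq_fib, show 2 * (t - 1) = 2 * t - 2 by omega, Nat.cast_mul]
  exact mul_le_mul_of_nonneg_left (ceil_sub_add_one_div_three_le (by omega) ht.2)
    (Nat.cast_nonneg _)

theorem sum_odd_le_fibSaving (κ : ℕ) :
    ∑ t ∈ Finset.Icc 1 (κ - 1),
      1 / (2 ^ (2 * t - 1) * √5) * ((1 + √5) ^ (2 * t - 1) - (1 - √5) ^ (2 * t - 1))
        * (⌈((κ : ℝ) - (t : ℝ) + 1) / 3⌉ : ℝ) ≤ (fibSaving 0 (κ + 1) : ℝ) := by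
  rw [fibSaving_zero]
  have h := sum_Icc_pred_le (fun j => Nat.fib (2 * j + 1) * ((κ - j) / 2)) le_rfl κ
  refine le_trans (Finset.sum_le_sum fun t ht => ?_) h
  rw [Finset.mem_Icc] at ht
  rw [binet_eq_fib, show 2 * (t - 1) + 1 = 2 * t - 1 by omega, Nat.cast_mul]
  exact mul_le_mul_of_nonneg_left (ceil_sub_add_one_div_three_le ht.1 ht.2) (Nat.cast_nonneg _)

theorem card_le_bipartiteMixedMooreBound_sub {V : Type*} [Fintype V] {G : MixedGraph V}
    (hbip : G.IsBipartite) (hreg : G.IsTotallyRegular 1 1) {b c k : ℕ} (hb : b < 2) (hc : 2 ≤ c)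
    (hk : k + 1 = 2 * c + b) (hdiam : G.diam = k) :
    (Fintype.card V : ℝ) ≤ bipartiteMixedMooreBound 1 1 k - 2 * (fibSaving b c : ℝ) := by
  have h : (Fintype.card V : ℝ) + 2 * fibSaving b c + 2 ≤ 2 * Nat.fib (k + 2) := by
    exact_mod_cast card_add_fibSaving_le hbip hreg hb hc hk hdiam
  rw [bipartiteMixedMooreBound_one_one]
  linarith

end ClosedForms
end MixedGraph

theorem theorem4p1 {V : Type*} [Fintype V] (G : MixedGraph V)
    (hbip : G.IsBipartite) (hreg : G.IsTotallyRegular 1 1) :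
    (∀ κ : ℕ, 3 ≤ κ → G.diam = ((2 * κ : ℕ) : ℕ∞) →
      (Fintype.card V : ℝ) ≤ bipartiteMixedMooreBound 1 1 (2 * κ)
        - 2 * (⌈(κ : ℝ) / 3⌉ : ℝ)
        - 2 * ∑ t ∈ Finset.Icc 2 (κ - 1),
            1 / (2 ^ (2 * t - 2) * √5)
              * ((1 + √5) ^ (2 * t - 2) - (1 - √5) ^ (2 * t - 2))
              * (⌈((κ : ℝ) - (t : ℝ) + 1) / 3⌉ : ℝ)) ∧
    (∀ κ : ℕ, κ = 2 → G.diam = ((2 * κ : ℕ) : ℕ∞) →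
      (Fintype.card V : ℝ) ≤ bipartiteMixedMooreBound 1 1 (2 * κ)
        - 2 * (⌈(κ : ℝ) / 3⌉ : ℝ)) ∧
    (∀ κ : ℕ, 2 ≤ κ → G.diam = ((2 * κ + 1 : ℕ) : ℕ∞) →
      (Fintype.card V : ℝ) ≤ bipartiteMixedMooreBound 1 1 (2 * κ + 1)
        - 2 * ∑ t ∈ Finset.Icc 1 (κ - 1),
            1 / (2 ^ (2 * t - 1) * √5)
              * ((1 + √5) ^ (2 * t - 1) - (1 - √5) ^ (2 * t - 1))
              * (⌈((κ : ℝ) - (t : ℝ) + 1) / 3⌉ : ℝ)) := by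
  have heven : ∀ κ : ℕ, 2 ≤ κ → G.diam = ((2 * κ : ℕ) : ℕ∞) → _ := fun κ hκ hdiam =>
    -- Even diameter: `b = 1` and `c = κ`, fixed by `one_lt_two` and `hκ`.
    MixedGraph.card_le_bipartiteMixedMooreBound_sub hbip hreg one_lt_two hκ rfl hdiam
  refine ⟨fun κ hκ hdiam => ?_, fun κ hκ hdiam => ?_, fun κ hκ hdiam => ?_⟩
  · have h := heven κ (by omega) hdiam
    have hs := MixedGraph.sum_even_le_fibSaving (κ := κ) (by omega)
    linarith
  · have h := heven κ hκ.ge hdiam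
    have hs := MixedGraph.sum_even_le_fibSaving (κ := κ) hκ.ge
    subst hκ
    rw [Finset.Icc_eq_empty (by norm_num), Finset.sum_empty] at hs
    linarith
  · have h := MixedGraph.card_le_bipartiteMixedMooreBound_sub hbip hreg (b := 0) (c := κ + 1)
      two_pos (by omega) (by ring) hdiam
    have hs := MixedGraph.sum_odd_le_fibSaving κ
    linarith
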